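/- Let $X=(V,E)$ be an infinite, connected, simple undirected graph of bounded degree (there is $D<\infty$ such that every vertex has at most $D$ neighbours). Suppose that $X$, as a metric graph all of whose edges have length $1$, is quasi-isometric to a CAT(0) space, and that there is no bounded ball $B$ of $X$ such that $X\setminus B$ is acyclic (contains no cycle). Let $\nu$ be a probability measure on $[0,\infty)$ with $\nu(\{0\})=0$, with finite mean $\mathbb{E}\,\omega_e=\int t\,d\nu(t)<\infty$, and with unbounded support, that is, $\nu((R,\infty))>0$ for all $R<\infty$. Let $\omega=(\omega_e)_{e\in E}$ be distributed according to the product measure $\nu^{\otimes E}$ on $[0,\infty)^E$, and let $X_\omega$ be the metric realization of the weighted graph $(X,\omega)$: each edge $e$ is replaced by an interval of length $\omega_e$, and the distance is the induced path metric, so that the distance of two vertices is the infimum of the sums $\sum\omega_e$ along the edge paths joining them (points at distance zero being identified). Then for almost every $\omega$, $X_\omega$ is not quasi-isometric to any CAT(0) space. -/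

import Mathlib

open MeasureTheory
open scoped NNReal ENNReal

/-! ### Quasi-isometries and CAT(0) spaces -/

/-- `f` is a `(q, Q)`-quasi-isometry: a `(q, Q)`-quasi-isometric embedding whose image is
`Q`-dense. -/
def IsQuasiIsometry {X Y : Type*} [MetricSpace X] [MetricSpace Y] (q Q : ℝ) (f : X → Y) : Prop :=
  (∀ x₁ x₂ : X, (1 / q) * dist x₁ x₂ - Q ≤ dist (f x₁) (f x₂) ∧
    dist (f x₁) (f x₂) ≤ q * dist x₁ x₂ + Q) ∧
  ∀ y : Y, ∃ x : X, dist y (f x) ≤ Q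

/-- `X` is quasi-isometric to `Y`. -/
def QuasiIsometric (X Y : Type*) [MetricSpace X] [MetricSpace Y] : Prop :=
  ∃ q Q : ℝ, 1 ≤ q ∧ 0 ≤ Q ∧ ∃ f : X → Y, IsQuasiIsometry q Q f

/-- `γ`, restricted to `[0, dist x y]`, is a geodesic segment from `x` to `y`. -/
def IsGeodesicSegment {Y : Type*} [MetricSpace Y] (γ : ℝ → Y) (x y : Y) : Prop :=
  γ 0 = x ∧ γ (dist x y) = y ∧
    ∀ s ∈ Set.Icc 0 (dist x y), ∀ t ∈ Set.Icc 0 (dist x y), dist (γ s) (γ t) = |s - t|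

/-- `Y` is a CAT(0) space: a geodesic metric space in which, for every geodesic triangle `p q r`
and all points on two of its sides `[p, q]` and `[p, r]`, the distance of the two points is at
most that of the comparison points in a Euclidean triangle with the same side lengths. (The third
side exists, as the space is geodesic, and does not enter the inequality.) -/
def IsCAT0 (Y : Type*) [MetricSpace Y] : Prop :=
  (∀ x y : Y, ∃ γ : ℝ → Y, IsGeodesicSegment γ x y) ∧
  ∀ (p q r : Y) (α β : ℝ → Y), IsGeodesicSegment α p q → IsGeodesicSegment β p r →
    ∀ p' q' r' : EuclideanSpace ℝ (Fin 2),
      dist p' q' = dist p q → dist p' r' = dist p r → dist q' r' = dist q r →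
      ∀ s ∈ Set.Icc 0 (dist p q), ∀ t ∈ Set.Icc 0 (dist p r),
        ∀ x' ∈ segment ℝ p' q', ∀ y' ∈ segment ℝ p' r',
          dist p' x' = s → dist p' y' = t → dist (α s) (β t) ≤ dist x' y'

/-! ### Weighted graphs and their metric realization -/

namespace FPP

variable {V : Type*} {G : SimpleGraph V}

/-- The `ω`-length of an edge path. -/
noncomputable def walkLength (ω : G.edgeSet → ℝ≥0) {x y : V} (p : G.Walk x y) : ℝ :=
  (p.darts.map fun d => (ω ⟨d.edge, d.edge_mem⟩ : ℝ)).sum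

/-- The first-passage distance `d_ω` between vertices: the infimum of the `ω`-lengths of the edge
paths that join them. -/
noncomputable def passageTime (ω : G.edgeSet → ℝ≥0) (x y : V) : ℝ :=
  ⨅ p : G.Walk x y, walkLength ω p

theorem walkLength_nonneg (ω : G.edgeSet → ℝ≥0) {x y : V} (p : G.Walk x y) :
    0 ≤ walkLength ω p := by
  refine List.sum_nonneg ?_
  simp only [List.mem_map]
  rintro _ ⟨d, -, rfl⟩
  exact NNReal.coe_nonneg _

theorem bddBelow_walkLength (ω : G.edgeSet → ℝ≥0) (x y : V) :
    BddBelow (Set.range fun p : G.Walk x y => walkLength ω p) :=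
  ⟨0, by rintro _ ⟨p, rfl⟩; exact walkLength_nonneg ω p⟩

theorem passageTime_le (ω : G.edgeSet → ℝ≥0) {x y : V} (p : G.Walk x y) :
    passageTime ω x y ≤ walkLength ω p :=
  ciInf_le (bddBelow_walkLength ω x y) p

theorem passageTime_nonneg (ω : G.edgeSet → ℝ≥0) (x y : V) : 0 ≤ passageTime ω x y :=
  Real.iInf_nonneg fun p => walkLength_nonneg ω p

theorem passageTime_self (ω : G.edgeSet → ℝ≥0) (x : V) : passageTime ω x x = 0 :=
  le_antisymm (by simpa [walkLength] using passageTime_le ω (SimpleGraph.Walk.nil : G.Walk x x))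
    (passageTime_nonneg ω x x)

theorem passageTime_adj (ω : G.edgeSet → ℝ≥0) {x y : V} (h : G.Adj x y) :
    passageTime ω x y ≤ ω ⟨s(x, y), h⟩ := by
  simpa [walkLength] using passageTime_le ω (SimpleGraph.Walk.cons h SimpleGraph.Walk.nil)

theorem passageTime_triangle (hG : G.Connected) (ω : G.edgeSet → ℝ≥0) (x y z : V) :
    passageTime ω x z ≤ passageTime ω x y + passageTime ω y z := by
  have : Nonempty (G.Walk x y) := hG.preconnected x y
  have : Nonempty (G.Walk y z) := hG.preconnected y z
  have key : ∀ (p : G.Walk x y) (q : G.Walk y z),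
      passageTime ω x z ≤ walkLength ω p + walkLength ω q := fun p q => by
    have := passageTime_le ω (p.append q)
    simpa [walkLength, SimpleGraph.Walk.darts_append] using this
  have h1 : ∀ p : G.Walk x y, passageTime ω x z - walkLength ω p ≤ passageTime ω y z :=
    fun p => le_ciInf fun q => by linarith [key p q]
  have h2 : passageTime ω x z - passageTime ω y z ≤ passageTime ω x y :=
    le_ciInf fun p => by linarith [h1 p]
  linarith

theorem walkLength_reverse (ω : G.edgeSet → ℝ≥0) {x y : V} (p : G.Walk x y) :
    walkLength ω p.reverse = walkLength ω p := by
  simp only [walkLength, SimpleGraph.Walk.darts_reverse, List.map_reverse, List.sum_reverse,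
    List.map_map]
  congr 1
  refine List.map_congr_left fun d _ => ?_
  simp [Function.comp, SimpleGraph.Dart.edge_symm]

theorem passageTime_comm (hG : G.Connected) (ω : G.edgeSet → ℝ≥0) (x y : V) :
    passageTime ω x y = passageTime ω y x := by
  have key : ∀ x y : V, passageTime ω x y ≤ passageTime ω y x := fun x y => by
    have : Nonempty (G.Walk y x) := hG.preconnected y x
    exact le_ciInf fun p => walkLength_reverse ω p ▸ passageTime_le ω p.reverse
  exact le_antisymm (key x y) (key y x)

/-- A name for a point of the metric graph in which every edge `e` is an interval of length `ω e`:
the point of the edge `{a, b}` at distance `s` from `a` and `t` from `b` along the edge. A vertex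
`a` may also be written with `b = a` and `s = t = 0`. A point has several names (the two
orientations of the edge; an endpoint shared by edges); these have distance zero from
each other and are identified in `MetricRealization` below. -/
@[ext]
structure EdgePoint (hG : G.Connected) (ω : G.edgeSet → ℝ≥0) where
  a : V
  b : V
  s : ℝ
  t : ℝ
  s_nonneg : 0 ≤ s
  t_nonneg : 0 ≤ t
  valid : (a = b ∧ s = 0 ∧ t = 0) ∨ ∃ h : G.Adj a b, s + t = ω ⟨s(a, b), h⟩

namespace EdgePoint

variable {hG : G.Connected} {ω : G.edgeSet → ℝ≥0}

/-- The length of a shortest connection of two points that passes through an endpoint of the edge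
of `x` and an endpoint of the edge of `y`. -/
noncomputable def through (x y : EdgePoint hG ω) : ℝ :=
  min (min (x.s + passageTime ω x.a y.a + y.s) (x.s + passageTime ω x.a y.b + y.t))
    (min (x.t + passageTime ω x.b y.a + y.s) (x.t + passageTime ω x.b y.b + y.t))

open Classical in
/-- The length distance of two points: on a common edge the connection inside that edge competes
with the connections through the endpoints. -/
noncomputable def distance (x y : EdgePoint hG ω) : ℝ :=
  if s(x.a, x.b) = s(y.a, y.b) then
    min |x.s - (if y.a = x.a then y.s else y.t)| (through x y)
  else through x y

theorem sum_eq_of_sameEdge {x y : EdgePoint hG ω} (h : s(x.a, x.b) = s(y.a, y.b)) :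
    x.s + x.t = y.s + y.t := by
  rcases x.valid with ⟨h1, h2, h3⟩ | ⟨hx, h1⟩ <;> rcases y.valid with ⟨h4, h5, h6⟩ | ⟨hy, h4⟩
  · rw [h2, h3, h5, h6]
  · rw [h1] at h
    have := hy.ne
    rcases Sym2.eq_iff.1 h with ⟨h7, h8⟩ | ⟨h7, h8⟩ <;> exact absurd (h7.symm.trans h8) (by tauto)
  · rw [h4] at h
    have := hx.ne
    rcases Sym2.eq_iff.1 h with ⟨h7, h8⟩ | ⟨h7, h8⟩ <;> exact absurd (h7.trans h8.symm) (by tauto)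
  · rw [h1, h4]
    congr 2
    exact Subtype.ext h

open Classical in
theorem sameEdge_cases {x y : EdgePoint hG ω} (h : s(x.a, x.b) = s(y.a, y.b)) :
    (y.a = x.a ∧ y.b = x.b ∧ (if y.a = x.a then y.s else y.t) = y.s) ∨
      (y.a = x.b ∧ y.b = x.a ∧ (if y.a = x.a then y.s else y.t) = y.t) := by
  rcases Sym2.eq_iff.1 h with ⟨h1, h2⟩ | ⟨h1, h2⟩
  · exact Or.inl ⟨h1.symm, h2.symm, by rw [if_pos h1.symm]⟩
  · refine Or.inr ⟨h2.symm, h1.symm, ?_⟩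
    split_ifs with h3
    · rcases y.valid with ⟨-, h5, h6⟩ | ⟨hy, -⟩
      · rw [h5, h6]
      · exact absurd (h3.trans h1) hy.ne
    · rfl

theorem passageTime_le_sum (x : EdgePoint hG ω) : passageTime ω x.a x.b ≤ x.s + x.t := by
  rcases x.valid with ⟨h1, h2, h3⟩ | ⟨hx, h1⟩
  · rw [h1, h2, h3, passageTime_self]; simp
  · rw [h1]; exact passageTime_adj ω hx

theorem through_nonneg (x y : EdgePoint hG ω) : 0 ≤ through x y := by
  have := x.s_nonneg; have := x.t_nonneg; have := y.s_nonneg; have := y.t_nonneg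
  have h := passageTime_nonneg ω
  refine le_min (le_min ?_ ?_) (le_min ?_ ?_)
  · linarith [h x.a y.a]
  · linarith [h x.a y.b]
  · linarith [h x.b y.a]
  · linarith [h x.b y.b]

theorem through_comm (x y : EdgePoint hG ω) : through x y = through y x := by
  unfold through
  rw [passageTime_comm hG ω x.a y.a, passageTime_comm hG ω x.a y.b,
    passageTime_comm hG ω x.b y.a, passageTime_comm hG ω x.b y.b, min_min_min_comm]
  congr 2 <;> ring

theorem distance_le_through (x y : EdgePoint hG ω) : distance x y ≤ through x y := by
  unfold distance
  by_cases h : s(x.a, x.b) = s(y.a, y.b)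
  · rw [if_pos h]; exact min_le_right _ _
  · rw [if_neg h]

theorem distance_nonneg (x y : EdgePoint hG ω) : 0 ≤ distance x y := by
  unfold distance; split_ifs
  · exact le_min (abs_nonneg _) (through_nonneg x y)
  · exact le_min (abs_nonneg _) (through_nonneg x y)
  · exact through_nonneg x y

theorem distance_self (x : EdgePoint hG ω) : distance x x = 0 := by
  unfold distance; simp [through_nonneg x x]

open Classical in
theorem distance_comm (x y : EdgePoint hG ω) : distance x y = distance y x := by
  unfold distance
  by_cases h : s(x.a, x.b) = s(y.a, y.b)
  · rw [if_pos h, if_pos h.symm, through_comm x y]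
    congr 1
    have e := sum_eq_of_sameEdge h
    rcases sameEdge_cases h with ⟨h1, h2, h3⟩ | ⟨h1, h2, h3⟩ <;>
      rcases sameEdge_cases h.symm with ⟨h4, h5, h6⟩ | ⟨h4, h5, h6⟩ <;> rw [h3, h6]
    · exact abs_sub_comm _ _
    · rcases x.valid with ⟨-, h7, h8⟩ | ⟨hx, -⟩
      · have : y.s = 0 := by linarith [y.s_nonneg, y.t_nonneg]
        rw [h7, h8, this]
      · exact absurd (h5.trans h1) hx.symm.ne
    · rcases x.valid with ⟨-, h7, h8⟩ | ⟨hx, -⟩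
      · have : y.s = 0 := by linarith [y.s_nonneg, y.t_nonneg]
        have : y.t = 0 := by linarith [y.s_nonneg, y.t_nonneg]
        simp [*]
      · exact absurd (h4.trans h1) hx.ne
    · congr 1; linarith
  · rw [if_neg h, if_neg (fun h' => h h'.symm), through_comm]

theorem through_triangle (x y z : EdgePoint hG ω) :
    through x z ≤ through x y + through y z := by
  have h := passageTime_triangle hG ω
  have hy := passageTime_le_sum y
  have hy' : passageTime ω y.b y.a ≤ y.s + y.t := by rwa [passageTime_comm hG]
  have hs := y.s_nonneg
  have ht := y.t_nonneg
  have key : ∀ (u v : V) (c d : ℝ),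
      c + passageTime ω u v + d ≤
        min (c + passageTime ω u y.a + y.s) (c + passageTime ω u y.b + y.t) +
        min (y.s + passageTime ω y.a v + d) (y.t + passageTime ω y.b v + d) := by
    intro u v c d
    have h1 := h u y.a v
    have h2 := h u y.b v
    have h3 := h y.a y.b v
    have h4 := h y.b y.a v
    rcases min_choice (c + passageTime ω u y.a + y.s) (c + passageTime ω u y.b + y.t) with e | e <;>
    rcases min_choice (y.s + passageTime ω y.a v + d) (y.t + passageTime ω y.b v + d) with e' | e' <;>
    rw [e, e'] <;> linarith
  have k1 := key x.a z.a x.s z.s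
  have k2 := key x.a z.b x.s z.t
  have k3 := key x.b z.a x.t z.s
  have k4 := key x.b z.b x.t z.t
  have e2 : through y z =
      min (min (y.s + passageTime ω y.a z.a + z.s) (y.t + passageTime ω y.b z.a + z.s))
        (min (y.s + passageTime ω y.a z.b + z.t) (y.t + passageTime ω y.b z.b + z.t)) := by
    unfold through; rw [min_min_min_comm]
  rw [e2]
  unfold through
  rcases min_choice (min (x.s + passageTime ω x.a y.a + y.s) (x.s + passageTime ω x.a y.b + y.t))
    (min (x.t + passageTime ω x.b y.a + y.s) (x.t + passageTime ω x.b y.b + y.t)) with e | e <;>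
  rcases min_choice
    (min (y.s + passageTime ω y.a z.a + z.s) (y.t + passageTime ω y.b z.a + z.s))
    (min (y.s + passageTime ω y.a z.b + z.t) (y.t + passageTime ω y.b z.b + z.t)) with e' | e' <;>
  rw [e, e']
  · exact ((min_le_left _ _).trans (min_le_left _ _)).trans k1
  · exact ((min_le_left _ _).trans (min_le_right _ _)).trans k2
  · exact ((min_le_right _ _).trans (min_le_left _ _)).trans k3
  · exact ((min_le_right _ _).trans (min_le_right _ _)).trans k4

open Classical in
theorem through_le_of_sameEdge {x y : EdgePoint hG ω} (h : s(x.a, x.b) = s(y.a, y.b))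
    (z : EdgePoint hG ω) :
    through x z ≤ |x.s - (if y.a = x.a then y.s else y.t)| + through y z := by
  have e := sum_eq_of_sameEdge h
  rw [← sub_le_iff_le_add']
  rcases sameEdge_cases h with ⟨h1, h2, h3⟩ | ⟨h1, h2, h3⟩ <;> rw [h3] <;> unfold through <;>
    rw [h1, h2]
  · have p1 := le_abs_self (x.s - y.s)
    have p2 := neg_abs_le (x.s - y.s)
    refine le_min (le_min ?_ ?_) (le_min ?_ ?_) <;> rw [sub_le_iff_le_add]
    · exact ((min_le_left _ _).trans (min_le_left _ _)).trans (by linarith)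
    · exact ((min_le_left _ _).trans (min_le_right _ _)).trans (by linarith)
    · exact ((min_le_right _ _).trans (min_le_left _ _)).trans (by linarith)
    · exact ((min_le_right _ _).trans (min_le_right _ _)).trans (by linarith)
  · have p1 := le_abs_self (x.s - y.t)
    have p2 := neg_abs_le (x.s - y.t)
    refine le_min (le_min ?_ ?_) (le_min ?_ ?_) <;> rw [sub_le_iff_le_add]
    · exact ((min_le_right _ _).trans (min_le_left _ _)).trans (by linarith)
    · exact ((min_le_right _ _).trans (min_le_right _ _)).trans (by linarith)
    · exact ((min_le_left _ _).trans (min_le_left _ _)).trans (by linarith)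
    · exact ((min_le_left _ _).trans (min_le_right _ _)).trans (by linarith)

open Classical in
theorem distance_eq_or (x y : EdgePoint hG ω) :
    distance x y = through x y ∨ (s(x.a, x.b) = s(y.a, y.b) ∧
      distance x y = |x.s - (if y.a = x.a then y.s else y.t)|) := by
  by_cases h : s(x.a, x.b) = s(y.a, y.b)
  · have : distance x y = min |x.s - (if y.a = x.a then y.s else y.t)| (through x y) := if_pos h
    rw [this]
    rcases min_choice |x.s - (if y.a = x.a then y.s else y.t)| (through x y) with e | e
    · exact Or.inr ⟨h, e⟩
    · exact Or.inl e
  · exact Or.inl (if_neg h)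

open Classical in
theorem distance_triangle (x y z : EdgePoint hG ω) :
    distance x z ≤ distance x y + distance y z := by
  have left : ∀ x y z : EdgePoint hG ω, s(x.a, x.b) = s(y.a, y.b) →
      distance x y = |x.s - (if y.a = x.a then y.s else y.t)| →
      distance x z ≤ distance x y + through y z := fun x y z h e => by
    rw [e]; exact (distance_le_through x z).trans (through_le_of_sameEdge h z)
  rcases distance_eq_or x y with e | ⟨h, e⟩
  · rcases distance_eq_or y z with e' | ⟨h', e'⟩
    · rw [e, e']; exact (distance_le_through x z).trans (through_triangle x y z)
    · rw [distance_comm y z]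
      have e'' : distance z y = |z.s - (if y.a = z.a then y.s else y.t)| ∨
          distance z y = through z y := by
        rcases distance_eq_or z y with h | h
        · exact Or.inr h
        · exact Or.inl h.2
      rcases e'' with e'' | e''
      · have := left z y x h'.symm e''
        rw [distance_comm x z, e, through_comm x y]; linarith
      · rw [e, e'', through_comm z y]
        exact (distance_le_through x z).trans (through_triangle x y z)
  · rcases distance_eq_or y z with e' | ⟨h', e'⟩
    · rw [e']; exact left x y z h e
    · have hxz := h.trans h'
      have e1 := sum_eq_of_sameEdge h
      have e2 := sum_eq_of_sameEdge h'
      have d : distance x z ≤ |x.s - (if z.a = x.a then z.s else z.t)| := by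
        have : distance x z = min |x.s - (if z.a = x.a then z.s else z.t)| (through x z) :=
          if_pos hxz
        rw [this]; exact min_le_left _ _
      refine d.trans ?_
      rw [e, e']
      have zero : ∀ w : EdgePoint hG ω, w.a = w.b → w.s = 0 ∧ w.t = 0 := fun w hw => by
        rcases w.valid with ⟨-, h7, h8⟩ | ⟨hx, -⟩
        · exact ⟨h7, h8⟩
        · exact absurd hw hx.ne
      by_cases hx : x.a = x.b
      · have := zero x hx
        have y1 : y.s = 0 := by linarith [y.s_nonneg, y.t_nonneg]
        have y2 : y.t = 0 := by linarith [y.s_nonneg, y.t_nonneg]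
        have z1 : z.s = 0 := by linarith [z.s_nonneg, z.t_nonneg]
        have z2 : z.t = 0 := by linarith [z.s_nonneg, z.t_nonneg]
        simp [*]
      · rcases sameEdge_cases h with ⟨h1, h2, h3⟩ | ⟨h1, h2, h3⟩ <;>
        rcases sameEdge_cases h' with ⟨h4, h5, h6⟩ | ⟨h4, h5, h6⟩ <;>
        rcases sameEdge_cases hxz with ⟨h7, h8, h9⟩ | ⟨h7, h8, h9⟩ <;> rw [h3, h6, h9] <;>
        first
        | exact abs_sub_le _ _ _
        | (exfalso; grind)
        | (rw [abs_le]; constructor <;>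
            linarith [le_abs_self (x.s - y.s), neg_abs_le (x.s - y.s), le_abs_self (x.s - y.t),
              neg_abs_le (x.s - y.t), le_abs_self (y.s - z.s), neg_abs_le (y.s - z.s),
              le_abs_self (y.s - z.t), neg_abs_le (y.s - z.t)])

noncomputable instance : PseudoMetricSpace (EdgePoint hG ω) where
  dist := distance
  dist_self := distance_self
  dist_comm := distance_comm
  dist_triangle := distance_triangle

end EdgePoint

/-- The metric realization `X_ω` of the weighted graph `(G, ω)`: every edge `e` is replaced by an
interval of length `ω e`, with the length metric. -/
abbrev MetricRealization (hG : G.Connected) (ω : G.edgeSet → ℝ≥0) : Type _ :=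
  SeparationQuotient (EdgePoint hG ω)

end FPP

/-- There is a uniform finite bound on the degrees of the vertices. -/
def SimpleGraph.BoundedDegree {V : Type*} (G : SimpleGraph V) : Prop :=
  ∃ D : ℕ, ∀ v : V, (G.neighborSet v).encard ≤ D

/-- There is no bounded ball outside of which `G` is acyclic. -/
def SimpleGraph.NotAcyclicOutsideBalls {V : Type*} (G : SimpleGraph V) : Prop :=
  ∀ (o : V) (r : ℕ), ¬ (G.induce {v | r < G.dist o v}).IsAcyclic

/-! The obstruction is a long edge that lies on a cycle. Collapsing everything outside an edge of
length `L` to a point is a `1`-Lipschitz map from the realization to a circle of length `L`. A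
CAT(0) space is contracted to a base point along geodesics without increasing distances. If the
realization is `(q, Q)`-quasi-isometric to such a space, this contraction, pulled back coarsely,
lifts the circle map on bounded sets to a real function, as soon as `L` exceeds a constant depending
only on `q` and `Q` (`exists_lift_of_isCAT0`). The lift is unchanged along paths that avoid the edge
and changes by `L` across it, so no such path joins its endpoints: all sufficiently long edges are
bridges (`exists_isBridge_of_lt_of_quasiIsometric`).

On the other hand, if no ball contains all cycles up to an acyclic remainder, then infinitely many
edges are not bridges, and independence together with unbounded support makes their lengths almost
surely unbounded. -/

/-! ### Differences modulo a period -/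

/-- The representative of `v - u` modulo `L` of least absolute value. -/
noncomputable def wrappedDiff (L u v : ℝ) : ℝ := v - u - L * round ((v - u) / L)

theorem wrappedDiff_self (L u : ℝ) : wrappedDiff L u u = 0 := by simp [wrappedDiff]

theorem abs_wrappedDiff_le {L : ℝ} (hL : 0 < L) (u v : ℝ) (k : ℤ) :
    |wrappedDiff L u v| ≤ |v - u - L * k| := by
  have key : ∀ z : ℤ, |v - u - L * z| = L * |(v - u) / L - z| := fun z => by
    rw [← abs_of_pos hL, ← abs_mul, abs_of_pos hL, mul_sub, mul_div_cancel₀ _ hL.ne']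
  rw [wrappedDiff, key, key]
  exact mul_le_mul_of_nonneg_left (round_le _ _) hL.le

theorem wrappedDiff_eq_sub {L u v : ℝ} (h : |v - u| < L / 2) : wrappedDiff L u v = v - u := by
  have hL : 0 < L := by linarith [abs_nonneg (v - u)]
  obtain ⟨h1, h2⟩ := abs_lt.1 h
  have : round ((v - u) / L) = 0 := by
    rw [round_eq_zero_iff]
    exact ⟨by rw [le_div_iff₀ hL]; linarith, by rw [div_lt_iff₀ hL]; linarith⟩
  simp [wrappedDiff, this]

/-- A loop on the circle made of four short jumps does not wind around: its total increment is a
multiple of `L` of absolute value at most `4 * C < L`, hence zero. -/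
theorem wrappedDiff_square {L C a b c d : ℝ} (hC : 4 * C < L)
    (hab : |wrappedDiff L a b| ≤ C) (hbd : |wrappedDiff L b d| ≤ C)
    (hac : |wrappedDiff L a c| ≤ C) (hcd : |wrappedDiff L c d| ≤ C) :
    wrappedDiff L a b + wrappedDiff L b d = wrappedDiff L a c + wrappedDiff L c d := by
  have hL : 0 < L := by linarith [abs_nonneg (wrappedDiff L a b)]
  obtain ⟨n, hn⟩ : ∃ n : ℤ, wrappedDiff L a b + wrappedDiff L b d
      - (wrappedDiff L a c + wrappedDiff L c d) = L * n := by
    refine ⟨round ((c - a) / L) + round ((d - c) / L) - round ((b - a) / L)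
      - round ((d - b) / L), ?_⟩
    simp only [wrappedDiff]
    push_cast
    ring
  rw [abs_le] at hab hbd hac hcd
  have h1 : (n : ℝ) < 1 := by
    by_contra! h
    nlinarith
  have h2 : (-1 : ℝ) < n := by
    by_contra! h
    nlinarith
  have h3 : n = 0 := by
    have : n < 1 := by exact_mod_cast h1
    have : -1 < n := by exact_mod_cast h2
    omega
  rw [h3, Int.cast_zero, mul_zero] at hn
  linarith

/-- A discrete homotopy lifting: the squares between two paths with a common start are filled one at
a time by `wrappedDiff_square`, so the lifted endpoints differ exactly by the last rung. -/
theorem sum_wrappedDiff_ladder {L C : ℝ} (hC : 4 * C < L) {h h' : ℕ → ℝ} (h0 : h 0 = h' 0) (k : ℕ)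
    (hh : ∀ j < k, |wrappedDiff L (h j) (h (j + 1))| ≤ C)
    (hh' : ∀ j < k, |wrappedDiff L (h' j) (h' (j + 1))| ≤ C)
    (hr : ∀ j ≤ k, |wrappedDiff L (h j) (h' j)| ≤ C) :
    ∑ j ∈ Finset.range k, wrappedDiff L (h' j) (h' (j + 1)) =
      ∑ j ∈ Finset.range k, wrappedDiff L (h j) (h (j + 1)) + wrappedDiff L (h k) (h' k) := by
  induction k with
  | zero => simp [h0, wrappedDiff_self]
  | succ k ih =>
    rw [Finset.sum_range_succ, Finset.sum_range_succ,
      ih (fun j hj => hh j (by omega)) (fun j hj => hh' j (by omega))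
        (fun j hj => hr j (by omega))]
    have := wrappedDiff_square hC (hh k (by omega)) (hr (k + 1) le_rfl) (hr k (by omega))
      (hh' k (by omega))
    linarith

/-! ### Cones in CAT(0) spaces -/

/-- Three numbers that satisfy the triangle inequalities are the side lengths of a triangle in the
Euclidean plane. -/
theorem exists_euclidean_triangle {a b c : ℝ} (ha : 0 ≤ a) (hb : 0 ≤ b) (hc : 0 ≤ c)
    (hab : c ≤ a + b) (hbc : a ≤ b + c) (hca : b ≤ c + a) :
    ∃ p q r : EuclideanSpace ℝ (Fin 2), dist p q = a ∧ dist p r = b ∧ dist q r = c := by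
  rcases ha.eq_or_lt with rfl | ha'
  · have : b = c := by linarith
    subst this
    refine ⟨!₂[0, 0], !₂[0, 0], !₂[b, 0], ?_, ?_, ?_⟩ <;>
      simp [EuclideanSpace.dist_eq, Real.dist_eq, Real.sqrt_sq hb]
  -- By the law of cosines, `u` is the abscissa of the third vertex when the side of length `a` lies
  -- on the first axis. The triangle inequalities give `|u| ≤ b`.
  · set u := (a ^ 2 + b ^ 2 - c ^ 2) / (2 * a) with hu
    have hua : 2 * a * u = a ^ 2 + b ^ 2 - c ^ 2 := by rw [hu]; field_simp
    have hub : 0 ≤ b ^ 2 - u ^ 2 := by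
      have h1 : u ≤ b := by rw [hu, div_le_iff₀ (by positivity)]; nlinarith
      have h2 : -b ≤ u := by rw [hu, le_div_iff₀ (by positivity)]; nlinarith
      nlinarith
    refine ⟨!₂[0, 0], !₂[a, 0], !₂[u, √(b ^ 2 - u ^ 2)], ?_, ?_, ?_⟩
    · simp [EuclideanSpace.dist_eq, Real.dist_eq, Real.sqrt_sq ha]
    · simp [EuclideanSpace.dist_eq, Real.dist_eq, Real.sq_sqrt hub, Real.sqrt_sq hb]
    · have : (a - u) ^ 2 + (b ^ 2 - u ^ 2) = c ^ 2 := by linarith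
      simp [EuclideanSpace.dist_eq, Real.dist_eq, Real.sq_sqrt hub, this, Real.sqrt_sq hc]

/-- In a CAT(0) space, the contraction along geodesics to a point does not increase distances. -/
theorem IsCAT0.dist_geodesic_le {Y : Type*} [MetricSpace Y] (hY : IsCAT0 Y) {p q r : Y}
    {α β : ℝ → Y} (hα : IsGeodesicSegment α p q) (hβ : IsGeodesicSegment β p r) {l : ℝ}
    (hl0 : 0 ≤ l) (hl1 : l ≤ 1) :
    dist (α (l * dist p q)) (β (l * dist p r)) ≤ dist q r := by
  obtain ⟨p', q', r', hpq, hpr, hqr⟩ := exists_euclidean_triangle (dist_nonneg (x := p) (y := q))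
    (dist_nonneg (x := p) (y := r)) (dist_nonneg (x := q) (y := r))
    (by simpa [dist_comm] using dist_triangle q p r)
    (by simpa [dist_comm] using dist_triangle p r q)
    (by simpa [dist_comm, add_comm] using dist_triangle p q r)
  have hmem : ∀ x : EuclideanSpace ℝ (Fin 2), AffineMap.lineMap p' x l ∈ segment ℝ p' x :=
    fun x => by
      rw [segment_eq_image_lineMap]
      exact ⟨l, ⟨hl0, hl1⟩, rfl⟩
  have hdist : ∀ x : EuclideanSpace ℝ (Fin 2),
      dist p' (AffineMap.lineMap p' x l) = l * dist p' x := fun x => by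
    rw [dist_left_lineMap, Real.norm_of_nonneg hl0]
  have hIcc : ∀ d : ℝ, 0 ≤ d → l * d ∈ Set.Icc 0 d := fun d hd =>
    ⟨by positivity, mul_le_of_le_one_left hd hl1⟩
  refine (hY.2 p q r α β hα hβ p' q' r' hpq hpr hqr _ (hIcc _ dist_nonneg) _
    (hIcc _ dist_nonneg) _ (hmem q') _ (hmem r') ?_ ?_).trans ?_
  · rw [hdist, hpq]
  · rw [hdist, hpr]
  · have : (AffineMap.lineMap p' q' l : EuclideanSpace ℝ (Fin 2)) - AffineMap.lineMap p' r' l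
        = l • (q' - r') := by
      simp only [AffineMap.lineMap_apply, vsub_eq_sub, vadd_eq_add]
      module
    rw [dist_eq_norm, this, norm_smul, Real.norm_of_nonneg hl0, ← dist_eq_norm, hqr]
    exact mul_le_of_le_one_left dist_nonneg hl1

/-- A function on a space that is quasi-isometric to a CAT(0) space and is `1`-Lipschitz modulo a
large period `L` can be lifted to a real valued function on bounded sets: the lift is obtained by
following the function along geodesics of the CAT(0) space. -/
theorem exists_lift_of_isCAT0 {P Y : Type*} [PseudoMetricSpace P] [MetricSpace Y] (hY : IsCAT0 Y)
    {q Q L : ℝ} (hq : 1 ≤ q) (hQ : 0 ≤ Q) (hL : 4 * (q * (q + 4 * Q)) < L) {f : P → Y}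
    (hf : ∀ x x' : P, (1 / q) * dist x x' - Q ≤ dist (f x) (f x') ∧
      dist (f x) (f x') ≤ q * dist x x' + Q)
    (hdense : ∀ y : Y, ∃ x : P, dist y (f x) ≤ Q) {φ : P → ℝ}
    (hφ : ∀ x x', |wrappedDiff L (φ x) (φ x')| ≤ dist x x') (y₀ : Y) :
    ∃ F : ℕ → P → ℝ, ∀ M : ℕ, 0 < M → ∀ x x' : P, dist y₀ (f x) ≤ M → dist y₀ (f x') ≤ M →
      dist x x' ≤ 1 → F M x' - F M x = wrappedDiff L (φ x) (φ x') := by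
  choose g hg using hdense
  choose γ hγ using hY.1 y₀
  have hq0 : 0 < q := by linarith
  have lower : ∀ x x' : P, dist x x' ≤ q * (dist (f x) (f x') + Q) := fun x x' => by
    have := (hf x x').1
    rw [sub_le_iff_le_add, one_div, inv_mul_le_iff₀ hq0] at this
    exact this
  -- The bound `q + Q` is that for the images of points at distance at most `1`. Passing to `f (g
  -- y)` and `f (g y')` costs `2 * Q`, and `lower` adds one more `Q`.
  have hgg : ∀ y y' : Y, dist y y' ≤ q + Q → dist (g y) (g y') ≤ q * (q + 4 * Q) := by
    intro y y' h
    refine (lower _ _).trans (mul_le_mul_of_nonneg_left ?_ hq0.le)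
    have h1 := dist_triangle4 (f (g y)) y y' (f (g y'))
    have h2 := hg y
    rw [dist_comm] at h2
    linarith [hg y']
  -- The values of `φ` along a coarse path from the base point to `x`: the geodesic to `f x` is cut
  -- into `M` equal parts and pulled back by `g`. The extra index `M + 1` ends the path at `x`
  -- itself, since `g (f x)` is only near `x`. The number of steps is the same for all points, so
  -- that two paths form a ladder.
  let H : ℕ → P → ℕ → ℝ := fun M x j =>
    if j ≤ M then φ (g (γ (f x) (j / M * dist y₀ (f x)))) else φ x
  refine ⟨fun M x => ∑ j ∈ Finset.range (M + 1), wrappedDiff L (H M x j) (H M x (j + 1)), ?_⟩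
  intro M hM x x' hx hx' hxx'
  have hM' : (0 : ℝ) < M := by exact_mod_cast hM
  -- As `M` also bounds the length of the geodesic, its parts have length at most `1`. The last
  -- jump, from `g (f x)` to `x`, is treated separately.
  have hvert : ∀ x : P, dist y₀ (f x) ≤ M → ∀ j < M + 1,
      |wrappedDiff L (H M x j) (H M x (j + 1))| ≤ q * (q + 4 * Q) := by
    intro x hx j hj
    rcases (Nat.lt_succ_iff.1 hj).lt_or_eq with h | rfl
    · simp only [H, if_pos h.le, if_pos (Nat.succ_le_of_lt h)]
      refine (hφ _ _).trans (hgg _ _ ?_)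
      have hI : ∀ i : ℕ, i ≤ M → (i : ℝ) / M * dist y₀ (f x) ∈ Set.Icc 0 (dist y₀ (f x)) :=
        fun i hi => ⟨by positivity, mul_le_of_le_one_left dist_nonneg
          (div_le_one_of_le₀ (by exact_mod_cast hi) hM'.le)⟩
      rw [(hγ (f x)).2.2 _ (hI j h.le) _ (hI (j + 1) h)]
      have : (j : ℝ) / M * dist y₀ (f x) - ((j + 1 : ℕ) : ℝ) / M * dist y₀ (f x)
          = -(dist y₀ (f x) / M) := by
        push_cast
        ring
      rw [this, abs_neg, abs_of_nonneg (by positivity)]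
      linarith [div_le_one_of_le₀ hx hM'.le]
    · simp only [H, if_pos le_rfl, if_neg (Nat.not_succ_le_self j)]
      refine (hφ _ _).trans ((lower _ _).trans (mul_le_mul_of_nonneg_left ?_ hq0.le))
      rw [div_self hM'.ne', one_mul, (hγ (f x)).2.1, dist_comm]
      linarith [hg (f x)]
  -- The CAT(0) inequality enters here: points at equal proportions of the two geodesics are no
  -- farther apart than `f x` and `f x'`.
  have hhor : ∀ j ≤ M + 1, |wrappedDiff L (H M x j) (H M x' j)| ≤ q * (q + 4 * Q) := by
    intro j _
    by_cases h : j ≤ M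
    · simp only [H, if_pos h]
      refine (hφ _ _).trans (hgg _ _ ?_)
      refine (hY.dist_geodesic_le (hγ _) (hγ _) (by positivity)
        (div_le_one_of_le₀ (by exact_mod_cast h) hM'.le)).trans ((hf x x').2.trans ?_)
      nlinarith
    · simp only [H, if_neg h]
      exact (hφ _ _).trans (by nlinarith)
  have h0 : H M x 0 = H M x' 0 := by simp [H, (hγ _).1]
  have key := sum_wrappedDiff_ladder hL h0 (M + 1) (hvert x hx) (hvert x' hx') hhor
  have hlast : ∀ x, H M x (M + 1) = φ x := fun x => by simp [H]
  rw [hlast, hlast] at key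
  simp only [key]
  ring

/-! ### The metric realization -/

namespace FPP.EdgePoint

variable {V : Type*} {G : SimpleGraph V} {hG : G.Connected} {ω : G.edgeSet → ℝ≥0}

/-- A vertex as a point of the metric realization. -/
def ofVertex (hG : G.Connected) (ω : G.edgeSet → ℝ≥0) (v : V) : EdgePoint hG ω :=
  ⟨v, v, 0, 0, le_rfl, le_rfl, Or.inl ⟨rfl, rfl, rfl⟩⟩

/-- The point of the edge `{u, v}` at distance `s` from `u` along the edge. -/
def onEdge (hG : G.Connected) (ω : G.edgeSet → ℝ≥0) {u v : V} (h : G.Adj u v) (s : ℝ)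
    (hs : s ∈ Set.Icc (0 : ℝ) (ω ⟨s(u, v), h⟩)) : EdgePoint hG ω :=
  ⟨u, v, s, ω ⟨s(u, v), h⟩ - s, hs.1, sub_nonneg.2 hs.2, Or.inr ⟨h, by ring⟩⟩

open Classical in
theorem dist_le_of_sameEdge {x y : EdgePoint hG ω} (h : s(x.a, x.b) = s(y.a, y.b)) :
    dist x y ≤ |x.s - (if y.a = x.a then y.s else y.t)| := by
  change distance x y ≤ _
  rw [distance, if_pos h]
  exact min_le_left _ _

theorem dist_le_through (x y : EdgePoint hG ω) : dist x y ≤ through x y :=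
  distance_le_through x y

theorem dist_onEdge_le {u v : V} (h : G.Adj u v) {s t : ℝ}
    (hs : s ∈ Set.Icc (0 : ℝ) (ω ⟨s(u, v), h⟩)) (ht : t ∈ Set.Icc (0 : ℝ) (ω ⟨s(u, v), h⟩)) :
    dist (onEdge hG ω h s hs) (onEdge hG ω h t ht) ≤ |s - t| := by
  simpa [onEdge] using dist_le_of_sameEdge (x := onEdge hG ω h s hs) (y := onEdge hG ω h t ht) rfl

theorem dist_ofVertex_onEdge_left {u v : V} (h : G.Adj u v)
    (hs : (0 : ℝ) ∈ Set.Icc (0 : ℝ) (ω ⟨s(u, v), h⟩)) :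
    dist (ofVertex hG ω u) (onEdge hG ω h 0 hs) = 0 := by
  refine le_antisymm ((dist_le_through _ _).trans ?_) dist_nonneg
  refine ((min_le_left _ _).trans (min_le_left _ _)).trans ?_
  simp [ofVertex, onEdge, passageTime_self]

theorem dist_onEdge_right_ofVertex {u v : V} (h : G.Adj u v)
    (hs : (ω ⟨s(u, v), h⟩ : ℝ) ∈ Set.Icc (0 : ℝ) (ω ⟨s(u, v), h⟩)) :
    dist (onEdge hG ω h _ hs) (ofVertex hG ω v) = 0 := by
  refine le_antisymm ((dist_le_through _ _).trans ?_) dist_nonneg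
  refine ((min_le_right _ _).trans (min_le_left _ _)).trans ?_
  simp [ofVertex, onEdge, passageTime_self]

open Classical in
/-- The coordinate, measured from `a`, on the edge `{a, b}`, extended by zero. Modulo the length
of the edge, this is the map to a circle that collapses everything outside the edge. -/
noncomputable def edgeCoord (a b : V) (x : EdgePoint hG ω) : ℝ :=
  if s(x.a, x.b) = s(a, b) then (if x.a = a then x.s else x.t) else 0

theorem edgeCoord_ofVertex (a b v : V) :
    edgeCoord a b (ofVertex hG ω v) = 0 := by
  rw [edgeCoord]
  split_ifs <;> rfl

theorem edgeCoord_onEdge_self {a b : V} (hab : G.Adj a b) {s : ℝ}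
    (hs : s ∈ Set.Icc (0 : ℝ) (ω ⟨s(a, b), hab⟩)) :
    edgeCoord a b (onEdge hG ω hab s hs) = s := by
  simp [edgeCoord, onEdge]

theorem edgeCoord_onEdge_of_ne {a b u v : V} (huv : G.Adj u v) (hne : s(u, v) ≠ s(a, b)) {s : ℝ}
    (hs : s ∈ Set.Icc (0 : ℝ) (ω ⟨s(u, v), huv⟩)) :
    edgeCoord a b (onEdge hG ω huv s hs) = 0 :=
  if_neg hne

theorem sum_eq_of_edge_eq {a b : V} (hab : G.Adj a b) {x : EdgePoint hG ω}
    (h : s(x.a, x.b) = s(a, b)) : x.s + x.t = ω ⟨s(a, b), hab⟩ := by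
  have h0 : (0 : ℝ) ∈ Set.Icc (0 : ℝ) (ω ⟨s(a, b), hab⟩) := ⟨le_rfl, NNReal.coe_nonneg _⟩
  have := sum_eq_of_sameEdge (x := x) (y := onEdge hG ω hab 0 h0) h
  simpa [onEdge] using this

/-- On the circle all vertices sit at the base point, so a point is no farther from it than from the
nearer end of its own edge. On the edge `{a, b}` the multiple is `0` or `1` according to whether
that end is `a` or `b`. -/
theorem exists_abs_edgeCoord_sub_le {a b : V} (hab : G.Adj a b) (x : EdgePoint hG ω) :
    ∃ k : ℤ, |edgeCoord a b x - ω ⟨s(a, b), hab⟩ * k| ≤ min x.s x.t := by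
  have hs := x.s_nonneg
  have ht := x.t_nonneg
  by_cases h : s(x.a, x.b) = s(a, b)
  · have hsum := sum_eq_of_edge_eq hab h
    rcases le_total x.s x.t with hst | hst <;> by_cases hxa : x.a = a
    · exact ⟨0, by rw [edgeCoord, if_pos h, if_pos hxa]; simp [hst, abs_of_nonneg hs]⟩
    · refine ⟨1, ?_⟩
      rw [edgeCoord, if_pos h, if_neg hxa, ← hsum, min_eq_left hst, abs_le]
      constructor <;> push_cast <;> linarith
    · refine ⟨1, ?_⟩
      rw [edgeCoord, if_pos h, if_pos hxa, ← hsum, min_eq_right hst, abs_le]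
      constructor <;> push_cast <;> linarith
    · exact ⟨0, by rw [edgeCoord, if_pos h, if_neg hxa]; simp [hst, abs_of_nonneg ht]⟩
  · exact ⟨0, by rw [edgeCoord, if_neg h]; simp [hs, ht]⟩

theorem min_add_min_le_through (x y : EdgePoint hG ω) :
    min x.s x.t + min y.s y.t ≤ through x y := by
  have h := passageTime_nonneg ω
  have h1 := min_le_left x.s x.t
  have h2 := min_le_right x.s x.t
  have h3 := min_le_left y.s y.t
  have h4 := min_le_right y.s y.t
  refine le_min (le_min ?_ ?_) (le_min ?_ ?_)
  · linarith [h x.a y.a]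
  · linarith [h x.a y.b]
  · linarith [h x.b y.a]
  · linarith [h x.b y.b]

/-- The collapse to the circle is `1`-Lipschitz. A connection through endpoints passes through the
base point of the circle, where the two distances to it add up; a connection inside one edge is
either preserved or collapsed. -/
theorem abs_wrappedDiff_edgeCoord_le {a b : V} (hab : G.Adj a b)
    (hL : (0 : ℝ) < ω ⟨s(a, b), hab⟩) (x y : EdgePoint hG ω) :
    |wrappedDiff (ω ⟨s(a, b), hab⟩) (edgeCoord a b x) (edgeCoord a b y)| ≤ dist x y := by
  classical
  change _ ≤ distance x y
  rcases distance_eq_or x y with e | ⟨h, e⟩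
  · rw [e]
    refine le_trans ?_ (min_add_min_le_through x y)
    obtain ⟨k, hk⟩ := exists_abs_edgeCoord_sub_le hab x
    obtain ⟨l, hl⟩ := exists_abs_edgeCoord_sub_le hab y
    refine (abs_wrappedDiff_le hL _ _ (l - k)).trans ?_
    rw [abs_le] at hk hl ⊢
    push_cast
    constructor <;> linarith
  · rw [e]
    refine (abs_wrappedDiff_le hL _ _ 0).trans ?_
    simp only [Int.cast_zero, mul_zero, sub_zero]
    by_cases hx : s(x.a, x.b) = s(a, b)
    · have hy := h.symm.trans hx
      have hxs := sum_eq_of_edge_eq hab hx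
      have hys := sum_eq_of_edge_eq hab hy
      have hne := hab.ne
      rw [edgeCoord, edgeCoord, if_pos hx, if_pos hy, abs_sub_comm]
      apply le_of_eq
      rcases Sym2.eq_iff.1 hx with ⟨h1, h2⟩ | ⟨h1, h2⟩ <;>
        rcases Sym2.eq_iff.1 hy with ⟨h3, h4⟩ | ⟨h3, h4⟩ <;>
        simp only [h1, h3, if_true, if_neg hne, if_neg hne.symm]
      · rw [abs_sub_comm]
        congr 1
        linarith
      · rw [abs_sub_comm]
        congr 1
        linarith
    · rw [edgeCoord, edgeCoord, if_neg hx, if_neg (h ▸ hx)]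
      simp
end FPP.EdgePoint

/-! ### Long edges are bridges -/

namespace FPP

variable {V : Type*} {G : SimpleGraph V} {hG : G.Connected} {ω : G.edgeSet → ℝ≥0}

open EdgePoint

/-- A function on the metric realization whose increments over distances at most `1`, on a set
that contains the edge `{u, v}`, are those of `φ` modulo `L`, where `φ` is `1`-Lipschitz along the
edge, increases along the edge as much as `φ`. -/
theorem sub_eq_of_lift_on_edge {L : ℝ} (hL : 2 < L) {φ F : EdgePoint hG ω → ℝ}
    {S : Set (EdgePoint hG ω)}
    (hF : ∀ x ∈ S, ∀ x' ∈ S, dist x x' ≤ 1 → F x' - F x = wrappedDiff L (φ x) (φ x'))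
    {u v : V} (h : G.Adj u v) (hu : ofVertex hG ω u ∈ S) (hv : ofVertex hG ω v ∈ S)
    (hS : ∀ s hs, onEdge hG ω h s hs ∈ S) {ψ : ℝ → ℝ} (hψ : ∀ s t, |ψ s - ψ t| ≤ |s - t|)
    (hφψ : ∀ s hs, φ (onEdge hG ω h s hs) = ψ s)
    (hφu : wrappedDiff L (φ (ofVertex hG ω u)) (ψ 0) = 0)
    (hφv : wrappedDiff L (ψ (ω ⟨s(u, v), h⟩)) (φ (ofVertex hG ω v)) = 0) :
    F (ofVertex hG ω v) - F (ofVertex hG ω u) = ψ (ω ⟨s(u, v), h⟩) - ψ 0 := by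
  set l : ℝ := ((ω ⟨s(u, v), h⟩ : ℝ≥0) : ℝ)
  have hl0 : 0 ≤ l := NNReal.coe_nonneg _
  have hm0 : (0 : ℝ) ∈ Set.Icc 0 l := ⟨le_rfl, hl0⟩
  have hml : l ∈ Set.Icc 0 l := ⟨hl0, le_rfl⟩
  -- Cutting the edge into `N` parts gives steps of length at most `1 < L / 2`, for which wrapped
  -- differences of `ψ` are ordinary differences.
  obtain ⟨N, hN⟩ := exists_nat_gt l
  have hN0 : (0 : ℝ) < N := hl0.trans_lt hN
  have hm : ∀ i : ℕ, i ≤ N → (i : ℝ) * (l / N) ∈ Set.Icc 0 l := fun i hi => by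
    refine ⟨by positivity, ?_⟩
    have : (i : ℝ) ≤ N := by exact_mod_cast hi
    calc (i : ℝ) * (l / N) ≤ N * (l / N) := by gcongr
      _ = l := by field_simp
  have walk : ∀ (i : ℕ) (hi : i ≤ N), F (onEdge hG ω h (i * (l / N)) (hm i hi))
      - F (onEdge hG ω h 0 hm0) = ψ (i * (l / N)) - ψ 0 := by
    intro i
    induction i with
    | zero => intro hi; simp
    | succ i ih =>
      intro hi
      have h1 := ih (by omega)
      have hstep : |(i : ℝ) * (l / N) - ((i + 1 : ℕ) : ℝ) * (l / N)| ≤ 1 := by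
        have : (i : ℝ) * (l / N) - ((i + 1 : ℕ) : ℝ) * (l / N) = -(l / N) := by push_cast; ring
        rw [this, abs_neg, abs_of_nonneg (by positivity)]
        exact div_le_one_of_le₀ hN.le hN0.le
      have h2 := hF _ (hS _ (hm i (by omega))) _ (hS _ (hm (i + 1) hi))
        ((dist_onEdge_le h _ _).trans hstep)
      rw [hφψ, hφψ, wrappedDiff_eq_sub] at h2
      · linarith
      · rw [abs_sub_comm]
        exact ((hψ _ _).trans hstep).trans_lt (by linarith)
  have h1 := hF _ hu _ (hS _ hm0) ((dist_ofVertex_onEdge_left h hm0).trans_le zero_le_one)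
  have h2 := hF _ (hS _ hml) _ hv ((dist_onEdge_right_ofVertex h hml).trans_le zero_le_one)
  have h3 := walk N le_rfl
  have h4 : (N : ℝ) * (l / N) = l := by field_simp
  simp only [h4] at h3
  rw [hφψ] at h1 h2
  rw [hφu] at h1
  rw [hφv] at h2
  linarith

/-- If the metric realization of a weighted graph is quasi-isometric to a CAT(0) space, then all
sufficiently long edges are bridges. -/
theorem exists_isBridge_of_lt_of_quasiIsometric {Y : Type*} [MetricSpace Y] (hY : IsCAT0 Y)
    (hqi : QuasiIsometric (MetricRealization hG ω) Y) :
    ∃ R : ℕ, ∀ e : G.edgeSet, (R : ℝ) < ω e → G.IsBridge e := by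
  obtain ⟨q, Q, hq, hQ, f₀, hf₀, hdense₀⟩ := hqi
  obtain ⟨R, hR⟩ := exists_nat_gt (4 * (q * (q + 4 * Q)))
  refine ⟨R, ?_⟩
  rintro ⟨e, he⟩ hlt
  induction e using Sym2.ind with | _ a b => ?_
  have hab : G.Adj a b := he
  set L : ℝ := ((ω ⟨s(a, b), hab⟩ : ℝ≥0) : ℝ)
  have hqq : 1 ≤ q * (q + 4 * Q) := by nlinarith
  have hL : 4 * (q * (q + 4 * Q)) < L := hR.trans hlt
  have hL0 : 0 < L := by linarith
  set f : EdgePoint hG ω → Y := fun x => f₀ (SeparationQuotient.mk x) 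
  have hf : ∀ x x' : EdgePoint hG ω, (1 / q) * dist x x' - Q ≤ dist (f x) (f x') ∧
      dist (f x) (f x') ≤ q * dist x x' + Q := fun x x' => by
    rw [← SeparationQuotient.dist_mk]
    exact hf₀ _ _
  have hdense : ∀ y : Y, ∃ x : EdgePoint hG ω, dist y (f x) ≤ Q := fun y => by
    obtain ⟨x, hx⟩ := hdense₀ y
    obtain ⟨x, rfl⟩ := SeparationQuotient.surjective_mk x
    exact ⟨x, hx⟩
  set y₀ := f (ofVertex hG ω a)
  obtain ⟨F, hF⟩ := exists_lift_of_isCAT0 hY hq hQ hL hf hdense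
    (abs_wrappedDiff_edgeCoord_le hab hL0) y₀
  -- The lift `F M` is controlled only on the points mapped into the ball of radius `M`. Each edge
  -- is bounded, so its points qualify for all large `M`; a walk needs finitely many such
  -- conditions.
  have hbdd : ∀ {u v : V} (h : G.Adj u v), ∀ᶠ M : ℕ in Filter.atTop, 0 < M ∧
      dist y₀ (f (ofVertex hG ω u)) ≤ M ∧ dist y₀ (f (ofVertex hG ω v)) ≤ M ∧
        ∀ s hs, dist y₀ (f (onEdge hG ω h s hs)) ≤ M := by
    intro u v h
    have hm0 : (0 : ℝ) ∈ Set.Icc (0 : ℝ) (ω ⟨s(u, v), h⟩) := ⟨le_rfl, NNReal.coe_nonneg _⟩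
    obtain ⟨M₀, hM₀⟩ := exists_nat_ge (max (dist y₀ (f (ofVertex hG ω u)))
      (max (dist y₀ (f (ofVertex hG ω v)))
        (dist y₀ (f (onEdge hG ω h 0 hm0)) + (q * ω ⟨s(u, v), h⟩ + Q))))
    filter_upwards [Filter.eventually_ge_atTop M₀, Filter.eventually_gt_atTop 0] with M hM hM0
    have hMM : (M₀ : ℝ) ≤ M := by exact_mod_cast hM
    simp only [max_le_iff] at hM₀
    refine ⟨hM0, hM₀.1.trans hMM, hM₀.2.1.trans hMM, fun s hs => ?_⟩
    refine (dist_triangle _ (f (onEdge hG ω h 0 hm0)) _).trans ?_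
    refine le_trans ?_ (hM₀.2.2.trans hMM)
    gcongr
    refine (hf _ _).2.trans ?_
    gcongr
    refine (dist_onEdge_le h hm0 hs).trans ?_
    rw [zero_sub, abs_neg, abs_of_nonneg hs.1]
    exact hs.2
  have hFS : ∀ M : ℕ, 0 < M → ∀ x ∈ {x | dist y₀ (f x) ≤ M}, ∀ x' ∈ {x | dist y₀ (f x) ≤ M},
      dist x x' ≤ 1 → F M x' - F M x = wrappedDiff L (edgeCoord a b x) (edgeCoord a b x') :=
    fun M hM x hx x' hx' hxx' => hF M hM x x' hx hx' hxx'
  have hwalk : ∀ {u v : V} (_ : (G.deleteEdges {s(a, b)}).Walk u v),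
      ∀ᶠ M : ℕ in Filter.atTop, F M (ofVertex hG ω v) = F M (ofVertex hG ω u) := by
    intro u v p
    induction p with
    | nil => exact Filter.Eventually.of_forall fun _ => rfl
    | cons h p ih =>
      rw [SimpleGraph.deleteEdges_adj, Set.mem_singleton_iff] at h
      filter_upwards [ih, hbdd h.1] with M hM1 hM2
      obtain ⟨hM0, hMu, hMv, hMe⟩ := hM2
      rw [hM1]
      have := sub_eq_of_lift_on_edge (by linarith) (hFS M hM0) h.1 hMu hMv hMe (ψ := fun _ => 0)
        (by simp) (fun s hs => edgeCoord_onEdge_of_ne h.1 h.2 hs)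
        (by rw [edgeCoord_ofVertex, wrappedDiff_self])
        (by rw [edgeCoord_ofVertex, wrappedDiff_self])
      linarith
  rw [SimpleGraph.isBridge_iff]
  rintro ⟨p⟩
  obtain ⟨M, hM1, hM0, hMu, hMv, hMe⟩ := ((hwalk p).and (hbdd hab)).exists
  have := sub_eq_of_lift_on_edge (by linarith) (hFS M hM0) hab hMu hMv hMe (ψ := fun s => s)
    (fun _ _ => le_rfl) (fun s hs => edgeCoord_onEdge_self hab hs)
    (by rw [edgeCoord_ofVertex, wrappedDiff_self])
    (by
      rw [edgeCoord_ofVertex]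
      -- The coordinate tends to `L` at the end `b` of the edge but is `0` at the vertex `b`; the
      -- two agree modulo `L`.
      have := abs_wrappedDiff_le hL0 L 0 (-1)
      simpa using this)
  -- The walk off the edge gives equal values at `a` and `b`, while crossing the edge gives the
  -- increment `L > 0`.
  simp only [hM1] at this
  linarith

end FPP

/-! ### Bridges and heavy edges -/

/-- Finitely many non-bridges would have all their endpoints in one ball. But a cycle outside that
ball is a cycle of `G`, and none of its edges is a bridge. -/
theorem SimpleGraph.NotAcyclicOutsideBalls.infinite_setOf_not_isBridge {V : Type*}
    {G : SimpleGraph V} [Nonempty V] (h : G.NotAcyclicOutsideBalls) :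
    {e : G.edgeSet | ¬ G.IsBridge e}.Infinite := by
  intro hfin
  obtain ⟨o⟩ := ‹Nonempty V›
  have hfin' : (⋃ e ∈ {e : G.edgeSet | ¬ G.IsBridge e}, {v | v ∈ (e : Sym2 V)}).Finite := by
    refine hfin.biUnion fun e _ => ?_
    obtain ⟨e, he⟩ := e
    induction e using Sym2.ind with | _ a b => ?_
    refine (Set.toFinite {a, b}).subset fun v hv => ?_
    simpa using hv
  obtain ⟨r, hr⟩ := (hfin'.image (G.dist o)).bddAbove
  refine h o r fun v c hc => ?_
  obtain ⟨d, hd⟩ := List.exists_mem_of_ne_nil c.darts fun hnil => hc.ne_nil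
    (SimpleGraph.Walk.eq_nil_iff_nil.2 (SimpleGraph.Walk.darts_eq_nil.1 hnil))
  have hc' := hc.map (f := (SimpleGraph.Embedding.induce {v | r < G.dist o v}).toHom)
    Subtype.val_injective
  have hadj : G.Adj d.fst d.snd := d.adj
  have hmem : s((d.fst : V), (d.snd : V)) ∈
      (c.map (SimpleGraph.Embedding.induce {v | r < G.dist o v}).toHom).edges := by
    rw [SimpleGraph.Walk.edges_map]
    exact List.mem_map.2 ⟨d.edge, List.mem_map.2 ⟨d, hd, rfl⟩, rfl⟩
  have hnb : ¬ G.IsBridge s((d.fst : V), (d.snd : V)) := fun hb =>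
    hb.notMem_edges_of_isCycle hc' hmem
  have h1 : G.dist o d.fst ≤ r := hr ⟨d.fst, Set.mem_biUnion
    (x := ⟨s((d.fst : V), (d.snd : V)), hadj⟩) hnb (Sym2.mem_mk_left _ _), rfl⟩
  exact absurd d.fst.2 (not_lt.2 h1)

/-- In an infinite family of independent copies of an unbounded random variable, almost surely
arbitrarily large values occur. -/
theorem ae_exists_lt_of_infinite {ι : Type*} (ν : Measure ℝ≥0) [IsProbabilityMeasure ν]
    (hν : ∀ R : ℝ≥0, 0 < ν (Set.Ioi R)) {s : Set ι} (hs : s.Infinite) :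
    ∀ᵐ ω : ι → ℝ≥0 ∂(Measure.infinitePi fun _ : ι => ν), ∀ R : ℕ, ∃ i ∈ s, (R : ℝ≥0) < ω i := by
  rw [ae_all_iff]
  intro R
  have hlt : ν (Set.Iic (R : ℝ≥0)) < 1 := by
    have h1 := prob_compl_eq_one_sub (μ := ν) (measurableSet_Ioi (a := (R : ℝ≥0)))
    rw [Set.compl_Ioi] at h1
    rw [h1]
    exact ENNReal.sub_lt_self ENNReal.one_ne_top one_ne_zero (hν R).ne'
  rw [ae_iff]
  -- If no value on `s` exceeds `R`, then this holds on every subset of `n` indices, which has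
  -- probability `ν (Set.Iic R) ^ n`; these powers tend to zero.
  refine le_antisymm (ge_of_tendsto' (ENNReal.tendsto_pow_atTop_nhds_zero_of_lt_one hlt)
    fun n => ?_) bot_le
  obtain ⟨t, hts, rfl⟩ := hs.exists_subset_card_eq n
  calc _ ≤ (Measure.infinitePi fun _ : ι => ν) (Set.pi t fun _ => Set.Iic (R : ℝ≥0)) := by
        refine measure_mono fun ω hω i hi => ?_
        by_contra hc
        exact hω ⟨i, hts hi, not_le.1 hc⟩
    _ = _ := by
        rw [Measure.infinitePi_pi _ fun _ _ => measurableSet_Iic, Finset.prod_const]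

theorem theoremB {V : Type*} (G : SimpleGraph V) [Infinite V] (hG : G.Connected)
    (hdeg : G.BoundedDegree) (hcyc : G.NotAcyclicOutsideBalls)
    -- `X` (all edges of length one) is quasi-isometric to a CAT(0) space
    (Y₀ : Type*) [MetricSpace Y₀] (hY₀ : IsCAT0 Y₀)
    (hX : QuasiIsometric (FPP.MetricRealization hG (fun _ => 1)) Y₀)
    -- the edge length distribution on `[0, ∞)`
    (ν : Measure ℝ≥0) [IsProbabilityMeasure ν] (hν_zero : ν {0} = 0)
    (hν_mean : ∫⁻ x, (x : ℝ≥0∞) ∂ν < ⊤) (hν_unbounded : ∀ R : ℝ≥0, 0 < ν (Set.Ioi R)) :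
    ∀ᵐ ω : G.edgeSet → ℝ≥0 ∂(Measure.infinitePi fun _ : G.edgeSet => ν),
      ∀ (Y : Type*) [MetricSpace Y], IsCAT0 Y →
        ¬ QuasiIsometric (FPP.MetricRealization hG ω) Y := by
  -- The almost sure event, that non-bridges of arbitrarily large length exist, does not involve
  -- `Y`; one null set therefore serves all CAT(0) spaces at once.
  filter_upwards [ae_exists_lt_of_infinite ν hν_unbounded hcyc.infinite_setOf_not_isBridge]
    with ω hω Y _ hY hqi
  obtain ⟨R, hR⟩ := FPP.exists_isBridge_of_lt_of_quasiIsometric hY hqi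
  obtain ⟨e, he, hlt⟩ := hω R
  exact he (hR e (by exact_mod_cast hlt))
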